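/- Let $m\ge 0$ be an integer, let $\mathbb S^m\subset\mathbb R^{m+1}$ be the Euclidean unit sphere, and let $c:\mathbb S^m\times\mathbb S^m\to[0,+\infty]$ be the cost $c(n,x)=-\log\langle n,x\rangle$ if $\langle n,x\rangle>0$ and $c(n,x)=+\infty$ otherwise. For $f:\mathbb S^m\to[-\infty,+\infty)$ put $f^c(n)=\inf_{x\in\mathbb S^m}\,(c(n,x)-f(x))$, and call *Kantorovich potential* a Lipschitz function $\varphi:\mathbb S^m\to\mathbb R$ such that $\varphi^c$ is real-valued and Lipschitz and $\varphi^{cc}:=(\varphi^c)^c=\varphi$. Its $c$-subdifferential is $\partial_c\varphi=\{(n,x)\in\mathbb S^m\times\mathbb S^m:\ \varphi(n)+\varphi^c(x)=c(n,x)\}$. **Theorem.** Let $\lambda$ and $\mu$ be Borel probability measures on $\mathbb S^m$ such that 1. (weak Aleksandrov condition) there is $\alpha\in(0,\pi/2)$ such that, for every closed set $F$ contained in a closed hemisphere of $\mathbb S^m$, $\mu(F)\le\lambda(F_{\pi/2-2\alpha})$, where $F_{\beta}=\{n\in\mathbb S^m:\ \exists\,x\in F,\ \langle n,x\rangle>\cos\beta\}$;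 2. $\lambda$ is absolutely continuous with respect to the uniform measure on $\mathbb S^m$; 3. the support of $\mu$ is not contained in a closed hemisphere. Let $\Gamma(\lambda,\mu)$ be the set of Borel probability measures on $\mathbb S^m\times\mathbb S^m$ with first marginal $\lambda$ and second marginal $\mu$, and let $\pi_o\in\Gamma(\lambda,\mu)$ be an optimal plan, that is, a minimizer of $\pi\mapsto\int c\,d\pi$ over $\Gamma(\lambda,\mu)$. Then there exists a Kantorovich potential $\varphi$ such that $$\operatorname{supp}\pi_o\cap\{c<+\infty\}\subset\partial_c\varphi .$$ -/

import Mathlib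

open MeasureTheory Set
open scoped NNReal ENNReal RealInnerProductSpace

noncomputable section

namespace GaussImage

/-- The unit sphere of the Euclidean space of dimension `m + 1`. -/
abbrev Sphere (m : ℕ) : Type :=
  Metric.sphere (0 : EuclideanSpace ℝ (Fin (m + 1))) 1

variable {m : ℕ}

/-- The Euclidean scalar product of two points of the unit sphere. -/
def ip (n x : Sphere m) : ℝ :=
  ⟪(n : EuclideanSpace ℝ (Fin (m + 1))), (x : EuclideanSpace ℝ (Fin (m + 1)))⟫

/-- The uniform (surface) measure of the unit sphere. Its normalization plays no role, since it is
only used to express absolute continuity. -/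
def uniformMeasure (m : ℕ) : Measure (Sphere m) :=
  (volume : Measure (EuclideanSpace ℝ (Fin (m + 1)))).toSphere

/-- The closed hemisphere centred at `u`. -/
def closedHemisphere (u : Sphere m) : Set (Sphere m) :=
  {x | 0 ≤ ip u x}

/-- `F_β = {n : ∃ x ∈ F, ⟨n, x⟩ > cos β}`. -/
def angularNhd (F : Set (Sphere m)) (β : ℝ) : Set (Sphere m) :=
  {n | ∃ x ∈ F, Real.cos β < ip n x}

/-- The weak Aleksandrov condition: for some `α ∈ (0, π/2)`, every closed set `F` contained in a
closed hemisphere satisfies `μ(F) ≤ lam(F_{π/2 - 2α})`. -/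
def WeakAleksandrov (lam μ : Measure (Sphere m)) : Prop :=
  ∃ α ∈ Ioo (0 : ℝ) (Real.pi / 2), ∀ F : Set (Sphere m), IsClosed F →
    (∃ u : Sphere m, F ⊆ closedHemisphere u) →
      μ F ≤ lam (angularNhd F (Real.pi / 2 - 2 * α))

/-- The cost `c(n, x) = - log ⟨n, x⟩` if `⟨n, x⟩ > 0`, and `+∞` otherwise. As `⟨n, x⟩ ≤ 1` on the
sphere, `- log ⟨n, x⟩` is nonnegative, so that `ENNReal.ofReal` does not change it. -/
def cost (n x : Sphere m) : ℝ≥0∞ :=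
  if 0 < ip n x then ENNReal.ofReal (-Real.log (ip n x)) else ⊤

/-- The transport plans between `lam` and `μ`: the Borel measures on the product with these
marginals. They are probability measures when `lam` and `μ` are. -/
def transportPlans (lam μ : Measure (Sphere m)) : Set (Measure (Sphere m × Sphere m)) :=
  {π | π.map Prod.fst = lam ∧ π.map Prod.snd = μ}

/-- The total cost `∫ c dπ` of a plan. -/
def planCost (π : Measure (Sphere m × Sphere m)) : ℝ≥0∞ :=
  ∫⁻ p, cost p.1 p.2 ∂π

/-- Optimal transport plans: the minimizers of the total cost among all transport plans. -/
def IsOptimalPlan (lam μ : Measure (Sphere m)) (π : Measure (Sphere m × Sphere m)) : Prop :=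
  π ∈ transportPlans lam μ ∧ ∀ π' ∈ transportPlans lam μ, planCost π ≤ planCost π'

/-- The `c`-transform `f^c(n) = inf_x (c(n, x) - f(x))`, with values in the extended reals. It is
used for functions `f < +∞`, for which the difference is never of the form `∞ - ∞`. -/
def cTransform (f : Sphere m → EReal) (n : Sphere m) : EReal :=
  ⨅ x : Sphere m, ((cost n x : ℝ≥0∞) : EReal) - f x

/-- A real function, seen as a function with values in the extended reals. -/
def toExt (φ : Sphere m → ℝ) (n : Sphere m) : EReal := (φ n : EReal)

/-- Kantorovich potentials: Lipschitz functions `φ` whose `c`-transform is (finite and) Lipschitz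
and that satisfy `φ^{cc} = φ`. The metric is the chordal one, which is bi-Lipschitz equivalent to
the spherical distance, so the Lipschitz functions are the same. -/
structure IsKantorovichPotential (φ : Sphere m → ℝ) : Prop where
  lipschitz : ∃ K : ℝ≥0, LipschitzWith K φ
  lipschitz_cTransform :
    ∃ (ψ : Sphere m → ℝ) (K : ℝ≥0), LipschitzWith K ψ ∧ cTransform (toExt φ) = toExt ψ
  cTransform_cTransform : cTransform (cTransform (toExt φ)) = toExt φ

/-- The `c`-subdifferential `{(n, x) : φ(n) + φ^c(x) = c(n, x)}`. -/
def cSubdifferential (φ : Sphere m → ℝ) : Set (Sphere m × Sphere m) :=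
  {p | toExt φ p.1 + cTransform (toExt φ) p.2 = ((cost p.1 p.2 : ℝ≥0∞) : EReal)}

end GaussImage

end

noncomputable section

namespace GaussImage

open Filter Topology

/-! Compactness of closed sets in the Hausdorff metric upgrades the weak Aleksandrov condition to a
uniform Hall condition (`WeakAleksandrov.exists_hall`): for one `s > 0`, each closed `F` has
`μ`-mass at most the `lam`-mass of the points seeing `F` with cosine above `s`.

The support of a finite-cost minimizer, where the cost is finite, is cyclically monotone, so closed
chains have nonnegative weight. The Hall condition lets one return, through finitely many small
cells, from near `p.2` to `p.2` along edges of cosine above `s / 4` (`exists_return_path`). Hence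
the cost is bounded on this set, and so are all chain weights from below
(`Path.exists_lower_bound`). Rockafellar's infimum over chains is then a bounded potential `g`;
transforming `-g` gives `φ`. Boundedness makes steep pairs irrelevant, so `φ` is Lipschitz.

The same return argument, for the bounded cost `max (s / 4 - ip) 0`, produces a plan of finite
logarithmic cost. -/

/-- `π` minimizes the transport cost `c` among the measures with the same marginals. -/
def Minimizes {X Y : Type*} [MeasurableSpace X] [MeasurableSpace Y]
    (c : X → Y → ℝ≥0∞) (π : Measure (X × Y)) : Prop :=
  ∀ π' : Measure (X × Y), π'.map Prod.fst = π.map Prod.fst → π'.map Prod.snd = π.map Prod.snd →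
    ∫⁻ p, c p.1 p.2 ∂π ≤ ∫⁻ p, c p.1 p.2 ∂π'

/-! ### Optimal plans have cyclically monotone support. -/

section CyclicMonotonicity

variable {X Y : Type*} [TopologicalSpace X] [TopologicalSpace Y] {c : X → Y → ℝ≥0∞}

/-- Continuity at the original and at the permuted pairs gives two families of neighbourhoods;
intersecting them requires reindexing by `σ.symm` in the first factor. Finiteness of the costs makes
adding `ε` a strict increase. -/
lemma exists_box_le (hc : Continuous fun p : X × Y => c p.1 p.2) {ι : Type*} [Fintype ι]
    (p : ι → X × Y) (hp : ∀ i, c (p i).1 (p i).2 < ⊤) (σ : Equiv.Perm ι)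
    (hσ : ∀ i, c (p (σ i)).1 (p i).2 < ⊤) {ε : ℝ≥0∞} (hε : 0 < ε) :
    ∃ (U : ι → Set X) (V : ι → Set Y), (∀ i, IsOpen (U i) ∧ (p i).1 ∈ U i) ∧
      (∀ i, IsOpen (V i) ∧ (p i).2 ∈ V i) ∧
      (∀ i, ∀ x ∈ U i, ∀ y ∈ V i, c (p i).1 (p i).2 ≤ c x y + ε) ∧
      ∀ i, ∀ x ∈ U (σ i), ∀ y ∈ V i, c x y ≤ c (p (σ i)).1 (p i).2 + ε := by
  have h1 : ∀ i, ∃ U V, IsOpen U ∧ (p i).1 ∈ U ∧ IsOpen V ∧ (p i).2 ∈ V ∧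
      ∀ x ∈ U, ∀ y ∈ V, c (p i).1 (p i).2 ≤ c x y + ε := by
    intro i
    have : ∀ᶠ q in 𝓝 (p i), c (p i).1 (p i).2 < c q.1 q.2 + ε := by
      have ht : Tendsto (fun q : X × Y => c q.1 q.2 + ε) (𝓝 (p i)) (𝓝 (c (p i).1 (p i).2 + ε)) :=
        (hc.add continuous_const).continuousAt
      exact ht.eventually_const_lt (ENNReal.lt_add_right (hp i).ne hε.ne')
    rw [nhds_prod_eq, eventually_prod_iff] at this
    obtain ⟨P, hP, Q, hQ, h⟩ := this
    obtain ⟨U, hU, hUo, hpU⟩ := eventually_nhds_iff.1 hP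
    obtain ⟨V, hV, hVo, hpV⟩ := eventually_nhds_iff.1 hQ
    exact ⟨U, V, hUo, hpU, hVo, hpV, fun x hx y hy => (h (hU x hx) (hV y hy)).le⟩
  have h2 : ∀ i, ∃ U V, IsOpen U ∧ (p (σ i)).1 ∈ U ∧ IsOpen V ∧ (p i).2 ∈ V ∧
      ∀ x ∈ U, ∀ y ∈ V, c x y ≤ c (p (σ i)).1 (p i).2 + ε := by
    intro i
    have : ∀ᶠ q in 𝓝 ((p (σ i)).1, (p i).2), c q.1 q.2 < c (p (σ i)).1 (p i).2 + ε := by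
      have ht : Tendsto (fun q : X × Y => c q.1 q.2) (𝓝 ((p (σ i)).1, (p i).2))
          (𝓝 (c (p (σ i)).1 (p i).2)) := hc.continuousAt
      exact ht.eventually_lt_const (ENNReal.lt_add_right (hσ i).ne hε.ne')
    rw [nhds_prod_eq, eventually_prod_iff] at this
    obtain ⟨P, hP, Q, hQ, h⟩ := this
    obtain ⟨U, hU, hUo, hpU⟩ := eventually_nhds_iff.1 hP
    obtain ⟨V, hV, hVo, hpV⟩ := eventually_nhds_iff.1 hQ
    exact ⟨U, V, hUo, hpU, hVo, hpV, fun x hx y hy => (h (hU x hx) (hV y hy)).le⟩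
  choose U V hUo hpU hVo hpV hUV using h1
  choose U' V' hUo' hpU' hVo' hpV' hUV' using h2
  refine ⟨fun i => U i ∩ U' (σ.symm i), fun i => V i ∩ V' i,
    fun i => ⟨(hUo i).inter (hUo' _), hpU i, ?_⟩,
    fun i => ⟨(hVo i).inter (hVo' i), hpV i, hpV' i⟩,
    fun i x hx y hy => hUV i x hx.1 y hy.1, fun i x hx y hy => hUV' i x ?_ y hy.2⟩
  · simpa using hpU' (σ.symm i)
  · simpa using hx.2

variable [MeasurableSpace X] [OpensMeasurableSpace X] [MeasurableSpace Y] [OpensMeasurableSpace Y]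

/-- The support of an optimal plan of finite cost is cyclically monotone. -/
theorem Minimizes.sum_le_sum [SecondCountableTopology X] [SecondCountableTopology Y]
    (hc : Continuous fun p : X × Y => c p.1 p.2) {π : Measure (X × Y)} [IsFiniteMeasure π]
    (hπ : Minimizes c π) (hfin : ∫⁻ p, c p.1 p.2 ∂π ≠ ⊤) {ι : Type*} [Fintype ι]
    (p : ι → X × Y) (hp : ∀ i, p i ∈ π.support ∧ c (p i).1 (p i).2 < ⊤) (σ : Equiv.Perm ι) :
    ∑ i, c (p i).1 (p i).2 ≤ ∑ i, c (p (σ i)).1 (p i).2 := by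
  classical
  by_cases hσ : ∀ i, c (p (σ i)).1 (p i).2 < ⊤
  swap
  · push Not at hσ
    obtain ⟨i, hi⟩ := hσ
    have : ∑ i, c (p (σ i)).1 (p i).2 = ⊤ :=
      ENNReal.sum_eq_top.2 ⟨i, Finset.mem_univ i, top_le_iff.1 hi⟩
    rw [this]
    exact le_top
  rcases isEmpty_or_nonempty ι with hι | hι
  · simp
  have key : ∀ ε : ℝ≥0∞, 0 < ε → ∑ i, c (p i).1 (p i).2 ≤
      ∑ i, c (p (σ i)).1 (p i).2 + (Fintype.card ι * 2 : ℕ) * ε := by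
    intro ε hε
    obtain ⟨U, V, hU, hV, h1, h2⟩ := exists_box_le hc p (fun i => (hp i).2) σ hσ hε
    set B : ι → Set (X × Y) := fun i => U i ×ˢ V i with hB
    have hBm : ∀ i, MeasurableSet (B i) := fun i =>
      (hU i).1.measurableSet.prod (hV i).1.measurableSet
    have hpos : ∀ i, π (B i) ≠ 0 := fun i =>
      ((Measure.mem_support_iff_forall _).1 (hp i).1 (B i)
        (prod_mem_nhds ((hU i).1.mem_nhds (hU i).2) ((hV i).1.mem_nhds (hV i).2))).ne'
    have hntop : ∀ i, π (B i) ≠ ⊤ := fun i => measure_ne_top _ _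
    set ρ : ι → Measure (X × Y) := fun i => (π (B i))⁻¹ • π.restrict (B i) with hρ
    have hρp : ∀ i, IsProbabilityMeasure (ρ i) := fun i => ⟨by
      simp [hρ, ENNReal.inv_mul_cancel (hpos i) (hntop i)]⟩
    have hα : ∀ i, IsProbabilityMeasure ((ρ i).map Prod.fst) := fun i =>
      Measure.isProbabilityMeasure_map measurable_fst.aemeasurable
    have hβ : ∀ i, IsProbabilityMeasure ((ρ i).map Prod.snd) := fun i =>
      Measure.isProbabilityMeasure_map measurable_snd.aemeasurable
    have hρB : ∀ i, ∀ᵐ q ∂(ρ i), q ∈ B i := fun i =>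
      Measure.ae_smul_measure (ae_restrict_mem (hBm i)) _
    have hαU : ∀ i, ∀ᵐ x ∂((ρ i).map Prod.fst), x ∈ U i := fun i =>
      (ae_map_iff measurable_fst.aemeasurable (hU i).1.measurableSet).2
        ((hρB i).mono fun q hq => hq.1)
    have hβV : ∀ i, ∀ᵐ x ∂((ρ i).map Prod.snd), x ∈ V i := fun i =>
      (ae_map_iff measurable_snd.aemeasurable (hV i).1.measurableSet).2
        ((hρB i).mono fun q hq => hq.2)
    -- The rerouted mass: sources from box `σ i`, targets from box `i`.
    set ν : ι → Measure (X × Y) := fun i =>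
      ((ρ (σ i)).map Prod.fst).prod ((ρ i).map Prod.snd) with hν
    have hνB : ∀ i, ∀ᵐ q ∂(ν i), q.1 ∈ U (σ i) ∧ q.2 ∈ V i := fun i =>
      (Measure.quasiMeasurePreserving_fst.ae (hαU (σ i))).and
        (Measure.quasiMeasurePreserving_snd.ae (hβV i))
    -- Each `ρ i` is at most `(π (B i))⁻¹ • π`, so dividing their sum by `S` keeps it below `π` even
    -- when boxes overlap.
    set S : ℝ≥0∞ := ∑ i, (π (B i))⁻¹ with hS
    have hS0 : S ≠ 0 := by
      obtain ⟨i⟩ := hι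
      intro h
      have := (Finset.sum_eq_zero_iff.1 h) i (Finset.mem_univ i)
      exact hntop i (ENNReal.inv_eq_zero.1 this)
    have hSt : S ≠ ⊤ := by
      simp [hS, ENNReal.sum_eq_top, hpos]
    set R : Measure (X × Y) := S⁻¹ • ∑ i, ρ i with hR
    have hRle : R ≤ π := by
      have : ∑ i, ρ i ≤ S • π := by
        rw [hS, Finset.sum_smul]
        refine Finset.sum_le_sum fun i _ => ?_
        refine Measure.le_iff.2 fun s hs => ?_
        simp only [hρ, Measure.smul_apply, smul_eq_mul]
        gcongr
        exact Measure.restrict_le_self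
      refine Measure.le_iff.2 fun s hs => ?_
      have h3 := Measure.le_iff.1 this s hs
      simp only [hR, Measure.smul_apply, smul_eq_mul] at h3 ⊢
      calc S⁻¹ * (∑ i, ρ i) s ≤ S⁻¹ * (S * π s) := by gcongr
        _ = π s := by rw [← mul_assoc, ENNReal.inv_mul_cancel hS0 hSt, one_mul]
    have hRfin : IsFiniteMeasure R := isFiniteMeasure_of_le π hRle
    set A : Measure (X × Y) := S⁻¹ • ∑ i, ν i with hA
    have hsub : π - R + R = π := Measure.sub_add_cancel_of_le hRle
    have hfst : A.map Prod.fst = R.map Prod.fst := by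
      rw [hA, hR, Measure.map_smul, Measure.map_smul]
      congr 1
      rw [← Measure.mapₗ_apply_of_measurable measurable_fst, map_sum,
        ← Measure.mapₗ_apply_of_measurable measurable_fst, map_sum]
      simp only [Measure.mapₗ_apply_of_measurable measurable_fst]
      rw [← Equiv.sum_comp σ fun i => (ρ i).map Prod.fst]
      refine Finset.sum_congr rfl fun i _ => ?_
      rw [hν]
      simp [Measure.map_fst_prod]
    have hsnd : A.map Prod.snd = R.map Prod.snd := by
      rw [hA, hR, Measure.map_smul, Measure.map_smul]
      congr 1
      rw [← Measure.mapₗ_apply_of_measurable measurable_snd, map_sum,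
        ← Measure.mapₗ_apply_of_measurable measurable_snd, map_sum]
      simp only [Measure.mapₗ_apply_of_measurable measurable_snd]
      refine Finset.sum_congr rfl fun i _ => ?_
      rw [hν]
      simp [Measure.map_snd_prod]
    -- Replacing `R` by `A` preserves both marginals; the finite cost of `π - R` then cancels.
    have hopt := hπ (π - R + A)
      (by rw [Measure.map_add _ _ measurable_fst, hfst, ← Measure.map_add _ _ measurable_fst, hsub])
      (by rw [Measure.map_add _ _ measurable_snd, hsnd, ← Measure.map_add _ _ measurable_snd, hsub])
    rw [lintegral_add_measure] at hopt
    nth_rewrite 1 [← hsub] at hopt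
    rw [lintegral_add_measure] at hopt
    have hfin' : ∫⁻ p, c p.1 p.2 ∂(π - R) ≠ ⊤ :=
      ne_top_of_le_ne_top hfin (lintegral_mono' Measure.sub_le le_rfl)
    have hRA := (ENNReal.add_le_add_iff_left hfin').1 hopt
    rw [hR, hA, lintegral_smul_measure, lintegral_smul_measure, smul_eq_mul, smul_eq_mul,
      ENNReal.mul_le_mul_iff_right (ENNReal.inv_ne_zero.2 hSt) (ENNReal.inv_ne_top.2 hS0),
      lintegral_finsetSum_measure, lintegral_finsetSum_measure] at hRA
    have hlow : ∀ i, c (p i).1 (p i).2 ≤ ∫⁻ q, c q.1 q.2 ∂(ρ i) + ε := by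
      intro i
      calc c (p i).1 (p i).2 = ∫⁻ _, c (p i).1 (p i).2 ∂(ρ i) := by simp
        _ ≤ ∫⁻ q, (c q.1 q.2 + ε) ∂(ρ i) :=
          lintegral_mono_ae ((hρB i).mono fun q hq => h1 i _ hq.1 _ hq.2)
        _ = _ := by rw [lintegral_add_right _ measurable_const]; simp
    have hup : ∀ i, ∫⁻ q, c q.1 q.2 ∂(ν i) ≤ c (p (σ i)).1 (p i).2 + ε := by
      intro i
      calc ∫⁻ q, c q.1 q.2 ∂(ν i) ≤ ∫⁻ _, (c (p (σ i)).1 (p i).2 + ε) ∂(ν i) :=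
          lintegral_mono_ae ((hνB i).mono fun q hq => h2 i _ hq.1 _ hq.2)
        _ = _ := by simp
    calc ∑ i, c (p i).1 (p i).2 ≤ ∑ i, (∫⁻ q, c q.1 q.2 ∂(ρ i) + ε) :=
          Finset.sum_le_sum fun i _ => hlow i
      _ = ∑ i, ∫⁻ q, c q.1 q.2 ∂(ρ i) + Fintype.card ι * ε := by
          simp [Finset.sum_add_distrib]
      _ ≤ ∑ i, ∫⁻ q, c q.1 q.2 ∂(ν i) + Fintype.card ι * ε := by gcongr
      _ ≤ ∑ i, (c (p (σ i)).1 (p i).2 + ε) + Fintype.card ι * ε := by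
          gcongr with i; exact hup i
      _ = _ := by
          simp only [Finset.sum_add_distrib, Finset.sum_const, Finset.card_univ, nsmul_eq_mul]
          push_cast
          ring
  refine ENNReal.le_of_forall_pos_le_add fun ε hε _ => ?_
  have hN : ((Fintype.card ι * 2 : ℕ) : ℝ≥0∞) ≠ 0 := by
    simp
  refine (key (ε / (Fintype.card ι * 2 : ℕ)) (ENNReal.div_pos (by simpa using hε.ne')
    (ENNReal.natCast_ne_top _))).trans ?_
  rw [ENNReal.mul_div_cancel hN (ENNReal.natCast_ne_top _)]

end CyclicMonotonicity

/-! ### Chains, their weights, and bounded potentials. -/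

section Paths

variable {X Y : Type*}

/-- `Path Γ c y z w` says that `w` is the weight of a chain from `y` to `z` through points of `Γ`:
the edge from `y` to `p.2`, where `p ∈ Γ`, has weight `c(p.1, y) - c(p.1, p.2)`. -/
inductive Path (Γ : Set (X × Y)) (c : X → Y → ℝ≥0∞) : Y → Y → ℝ → Prop
  | refl (y : Y) : Path Γ c y y 0
  | step {y z : Y} {w : ℝ} (p : X × Y) : Path Γ c y z w → p ∈ Γ → c p.1 z < ⊤ →
      Path Γ c y p.2 (w + (c p.1 z).toReal - (c p.1 p.2).toReal)

variable {Γ : Set (X × Y)} {c : X → Y → ℝ≥0∞}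

lemma Path.trans {x y z : Y} {v w : ℝ} (h : Path Γ c x y v) (h' : Path Γ c y z w) :
    Path Γ c x z (v + w) := by
  induction h' with
  | refl => simpa using h
  | step p _ hp hc ih =>
    convert ih.step p hp hc using 1
    ring

/-- Listing the points of a chain exposes its weight as a shifted sum minus a diagonal sum; when `y
= z` the shift is a cyclic permutation. -/
lemma Path.exists_fin {y z : Y} {w : ℝ} (h : Path Γ c y z w) :
    (y = z ∧ w = 0) ∨ ∃ (k : ℕ) (p : Fin (k + 1) → X × Y), (∀ i, p i ∈ Γ) ∧
      (p (Fin.last k)).2 = z ∧ c (p 0).1 y < ⊤ ∧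
      (∀ i : Fin k, c (p i.succ).1 (p i.castSucc).2 < ⊤) ∧
      w = (c (p 0).1 y).toReal + ∑ i : Fin k, (c (p i.succ).1 (p i.castSucc).2).toReal
        - ∑ i, (c (p i).1 (p i).2).toReal := by
  induction h with
  | refl => exact Or.inl ⟨rfl, rfl⟩
  | @step z w q _ hq hc ih =>
    right
    rcases ih with ⟨rfl, rfl⟩ | ⟨k, p, hp, hz, hy, hlt, hw⟩
    · exact ⟨0, fun _ => q, fun _ => hq, rfl, hc, fun i => i.elim0, by simp⟩
    · refine ⟨k + 1, Fin.snoc (α := fun _ => X × Y) p q, fun i => ?_, by simp, ?_, fun i => ?_, ?_⟩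
      · induction i using Fin.lastCases with
        | last => simpa using hq
        | cast i => simpa using hp i
      · rw [← Fin.castSucc_zero, Fin.snoc_castSucc]
        exact hy
      · induction i using Fin.lastCases with
        | last => simpa [hz] using hc
        | cast i =>
          rw [Fin.succ_castSucc, Fin.snoc_castSucc, Fin.snoc_castSucc]
          exact hlt i
      · rw [Fin.sum_univ_castSucc (n := k + 1), Fin.sum_univ_castSucc (n := k)]
        simp only [Fin.snoc_castSucc, Fin.snoc_last, Fin.succ_last, Fin.succ_castSucc, hz]
        rw [← Fin.castSucc_zero, Fin.snoc_castSucc, hw]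
        ring

/-- In a cyclically monotone set, closed chains have nonnegative weight. -/
lemma Path.nonneg_of_cyclicallyMonotone (hfin : ∀ p ∈ Γ, c p.1 p.2 < ⊤)
    (hΓ : ∀ (k : ℕ) (p : Fin k → X × Y), (∀ i, p i ∈ Γ) → ∀ σ : Equiv.Perm (Fin k),
      ∑ i, c (p i).1 (p i).2 ≤ ∑ i, c (p (σ i)).1 (p i).2)
    {y : Y} {w : ℝ} (h : Path Γ c y y w) : 0 ≤ w := by
  rcases h.exists_fin with ⟨-, rfl⟩ | ⟨k, p, hp, hz, hy, hlt, hw⟩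
  · exact le_rfl
  have h1 := hΓ (k + 1) p hp (finRotate (k + 1))
  have hrot : ∀ i, c (p (finRotate (k + 1) i)).1 (p i).2 < ⊤ := by
    intro i
    induction i using Fin.lastCases with
    | last => rw [finRotate_last, hz]; exact hy
    | cast i =>
      rw [finRotate_apply, Fin.coeSucc_eq_succ]
      exact hlt i
  have h2 := ENNReal.toReal_mono (ENNReal.sum_lt_top.2 fun i _ => hrot i).ne h1
  rw [ENNReal.toReal_sum fun i _ => (hfin _ (hp i)).ne, ENNReal.toReal_sum fun i _ => (hrot i).ne,
    Fin.sum_univ_castSucc (fun i => (c (p (finRotate (k + 1) i)).1 (p i).2).toReal)] at h2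
  simp only [hz, finRotate_apply, Fin.coeSucc_eq_succ, Fin.last_add_one] at h2
  linarith

/-- A finite family of cells such that, within a cell, one can go back to every point of `Γ` at a
bounded cost: then the weights of all chains are bounded below. -/
lemma Path.exists_lower_bound {ι : Type*} [Finite ι] (cell : Y → ι) {K : ℝ}
    (hclosed : ∀ (y : Y) (w : ℝ), Path Γ c y y w → 0 ≤ w)
    (hK : ∀ p ∈ Γ, (c p.1 p.2).toReal ≤ K)
    (hback : ∀ p ∈ Γ, ∀ y, cell y = cell p.2 → ∃ w ≤ K, Path Γ c y p.2 w) :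
    ∃ M, ∀ (y z : Y) (w : ℝ), Path Γ c y z w → -M ≤ w := by
  classical
  -- Induction on the cells that the chain may enter.
  have key : ∀ T : Finset ι, ∃ M, 0 ≤ M ∧ ∀ (y z : Y) (w : ℝ),
      Path {p ∈ Γ | cell p.2 ∈ T} c y z w → -M ≤ w := by
    intro T
    induction T using Finset.induction_on with
    | empty =>
      refine ⟨0, le_rfl, fun y z w h => ?_⟩
      cases h with
      | refl => simp
      | step p _ hp _ => simp at hp
    | insert a T _ ih =>
      obtain ⟨M, hM, ih⟩ := ih
      have hsame : ∀ p ∈ Γ, ∀ y w, cell y = cell p.2 → Path Γ c p.2 y w → -K ≤ w := by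
        intro p hp y w hy h
        obtain ⟨v, hv, h'⟩ := hback p hp y hy
        linarith [hclosed _ _ (h.trans h')]
      have mono : ∀ {U : Set ι} {y z w}, Path {p ∈ Γ | cell p.2 ∈ U} c y z w →
          Path Γ c y z w := by
        intro U y z w h
        induction h with
        | refl => exact .refl _
        | step p _ hp hc ih => exact ih.step p hp.1 hc
      -- Cut the chain at its first and last arrivals in cell `a`. The outer pieces are controlled
      -- by induction, up to one edge of weight at least `-K`; the middle piece is almost closed,
      -- and `hsame` bounds it below by `-K`.
      have main : ∀ (y z : Y) (w : ℝ), Path {p ∈ Γ | cell p.2 ∈ insert a T} c y z w →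
          Path {p ∈ Γ | cell p.2 ∈ T} c y z w ∨
          ∃ p ∈ Γ, ∃ v, cell p.2 = a ∧ cell v = a ∧ ∃ w₁ w₂ w₃, -(M + K) ≤ w₁ ∧
            Path Γ c p.2 v w₂ ∧ Path {p ∈ Γ | cell p.2 ∈ T} c v z w₃ ∧ w = w₁ + w₂ + w₃ := by
        intro y z w h
        induction h with
        | refl => exact Or.inl (.refl _)
        | @step z w q _ hq hc ih =>
          by_cases hqT : cell q.2 ∈ T
          · rcases ih with h | ⟨p, hp, v, hpa, hva, w₁, w₂, w₃, hw₁, h2, h3, rfl⟩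
            · exact Or.inl (h.step q ⟨hq.1, hqT⟩ hc)
            · exact Or.inr ⟨p, hp, v, hpa, hva, w₁, w₂, _, hw₁, h2, h3.step q ⟨hq.1, hqT⟩ hc,
                by ring⟩
          · have hqa : cell q.2 = a := by
              rcases Finset.mem_insert.1 hq.2 with h | h
              · exact h
              · exact absurd h hqT
            right
            rcases ih with h | ⟨p, hp, v, hpa, hva, w₁, w₂, w₃, hw₁, h2, h3, rfl⟩
            · refine ⟨q, hq.1, q.2, hqa, hqa, _, 0, 0, ?_, .refl _, .refl _,
                by rw [add_zero, add_zero]⟩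
              have := ih _ _ _ h
              have := hK q hq.1
              have : 0 ≤ (c q.1 z).toReal := ENNReal.toReal_nonneg
              linarith
            · exact ⟨p, hp, q.2, hpa, hqa, w₁, _, 0, hw₁,
                (h2.trans (mono h3)).step q hq.1 hc, .refl _, by ring⟩
      refine ⟨max M (2 * M + 2 * K), hM.trans (le_max_left _ _), fun y z w h => ?_⟩
      rcases main y z w h with h | ⟨p, hp, v, hpa, hva, w₁, w₂, w₃, hw₁, h2, h3, rfl⟩
      · linarith [ih _ _ _ h, le_max_left M (2 * M + 2 * K)]
      · have := hsame p hp v w₂ (hva.trans hpa.symm) h2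
        linarith [ih _ _ _ h3, le_max_right M (2 * M + 2 * K)]
  have := Fintype.ofFinite ι
  obtain ⟨M, -, hM⟩ := key Finset.univ
  exact ⟨M, fun y z w h => hM y z w (by simpa using h)⟩

/-- If the weights of all chains are bounded below, there are bounded potentials: a function `g`
of the end point of the chains such that `y ↦ c(n, y) + g y` is minimal at `y` when
`(n, y) ∈ Γ`. -/
lemma exists_bounded_potential {M : ℝ}
    (hM : ∀ (y z : Y) (w : ℝ), Path Γ c y z w → -M ≤ w) :
    ∃ g : Y → ℝ, (∀ y, -M ≤ g y ∧ g y ≤ 0) ∧ ∀ p ∈ Γ, ∀ y, c p.1 y < ⊤ →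
      (c p.1 p.2).toReal + g p.2 ≤ (c p.1 y).toReal + g y := by
  have hb : ∀ z, BddBelow {w | ∃ y, Path Γ c y z w} := fun z =>
    ⟨-M, fun w ⟨y, h⟩ => hM y z w h⟩
  -- The starting point is left free, so the trivial chain at `z` makes the infimum nonpositive
  -- everywhere. Appending an edge gives the last inequality.
  refine ⟨fun z => sInf {w | ∃ y, Path Γ c y z w}, fun z => ⟨?_, ?_⟩, fun p hp y hy => ?_⟩
  · exact le_csInf ⟨0, z, .refl z⟩ fun w ⟨y, h⟩ => hM y z w h
  · exact csInf_le (hb z) ⟨z, .refl z⟩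
  · rw [← sub_le_iff_le_add']
    refine le_csInf ⟨0, y, .refl y⟩ fun w ⟨x, h⟩ => ?_
    have := csInf_le (hb p.2) ⟨x, h.step p hp hy⟩
    linarith

end Paths

/-! ### Return chains of bounded cost from a Hall condition. -/

section Return

variable {m : ℕ}

lemma ip_comm (n x : Sphere m) : ip n x = ip x n := real_inner_comm _ _

lemma ip_self (n : Sphere m) : ip n n = 1 := by
  simp [ip]

lemma ip_le_one (n x : Sphere m) : ip n x ≤ 1 := by
  have := real_inner_le_norm (n : EuclideanSpace ℝ (Fin (m + 1))) x
  simpa [ip] using this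

lemma ip_le_add_dist (n x y : Sphere m) : ip n x ≤ ip n y + dist x y := by
  have h := real_inner_le_norm (n : EuclideanSpace ℝ (Fin (m + 1))) (x - y)
  rw [inner_sub_right, ← dist_eq_norm, norm_eq_of_mem_sphere, one_mul] at h
  have : dist (x : EuclideanSpace ℝ (Fin (m + 1))) y = dist x y := rfl
  unfold ip
  linarith

lemma ip_le_add_dist' (n n' x : Sphere m) : ip n x ≤ ip n' x + dist n n' := by
  rw [ip_comm n, ip_comm n']
  exact ip_le_add_dist x n n'

lemma continuous_ip : Continuous fun p : Sphere m × Sphere m => ip p.1 p.2 := by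
  unfold ip
  fun_prop

lemma exists_cells (X : Type*) [MetricSpace X] [CompactSpace X] {δ : ℝ} (hδ : 0 < δ) :
    ∃ (t : Set X) (_ : t.Finite) (cell : X → t), ∀ x y, cell x = cell y → dist x y < δ := by
  obtain ⟨t, -, ht, hcov⟩ := finite_cover_balls_of_compact (isCompact_univ (X := X)) (half_pos hδ)
  have : ∀ x : X, ∃ y : t, dist x y < δ / 2 := fun x => by
    obtain ⟨y, hy, hxy⟩ := mem_iUnion₂.1 (hcov (mem_univ x))
    exact ⟨⟨y, hy⟩, hxy⟩
  choose cell hcell using this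
  refine ⟨t, ht, cell, fun x y h => ?_⟩
  have h1 := hcell x
  have h2 := hcell y
  rw [← h] at h2
  linarith [dist_triangle_right x y (cell x)]

/-- Under a quantitative Hall condition, every point of the support of a plan lies on a closed
chain whose edges have a bounded cost. -/
lemma exists_return_path {π : Measure (Sphere m × Sphere m)} [IsFiniteMeasure π] {s : ℝ}
    (hs : 0 < s)
    (hall : ∀ F : Set (Sphere m), IsClosed F →
      π.map Prod.snd F ≤ π.map Prod.fst {n | ∃ x ∈ F, s < ip n x})
    {Γ : Set (Sphere m × Sphere m)} (hΓs : Γ ⊆ π.support) (hΓ : π Γᶜ = 0)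
    {c : Sphere m → Sphere m → ℝ≥0∞} {L : ℝ} (hL : 0 ≤ L)
    (hc : ∀ n x, s / 4 < ip n x → c n x ≤ ENNReal.ofReal L)
    {ι : Type*} [Finite ι] (cell : Sphere m → ι)
    (hcell : ∀ x y, cell x = cell y → dist x y < s / 4) :
    ∃ k : ℕ, ∀ p ∈ Γ, ∀ y, cell y = cell p.2 →
      ∃ w ≤ k * L - (c p.1 p.2).toReal, Path Γ c y p.2 w := by
  classical
  have := Fintype.ofFinite ι
  -- The cosine margin is spent as follows: `s / 4` for the neighbourhood `U`, `s / 4` for moving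
  -- within a cell, and `s / 4` for replacing `q.1` by `p.1` on the final edge.
  set r : ι → ι → Prop := fun a b =>
    ∃ q ∈ Γ, cell q.2 = b ∧ ∃ y, cell y = a ∧ s - s / 4 < ip q.1 y with hr
  have hedge : ∀ {q} {y}, s / 4 < ip q y → c q y < ⊤ ∧ (c q y).toReal ≤ L := fun {q y} h =>
    ⟨(hc q y h).trans_lt ENNReal.ofReal_lt_top, ENNReal.toReal_le_of_le_ofReal hL (hc q y h)⟩
  have real : ∀ a b, Relation.ReflTransGen r a b → ∃ k : ℕ, ∀ y, cell y = a →
      ∃ z w, cell z = b ∧ w ≤ k * L ∧ Path Γ c y z w := by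
    intro a b h
    induction h with
    | refl => exact ⟨0, fun y hy => ⟨y, 0, hy, by simp, .refl y⟩⟩
    | tail _ hab ih =>
      obtain ⟨k, ih⟩ := ih
      obtain ⟨q, hq, hqb, y', hy', hip⟩ := hab
      refine ⟨k + 1, fun y hy => ?_⟩
      obtain ⟨z, w, hz, hw, hp⟩ := ih y hy
      have hzy := hcell y' z (hy'.trans hz.symm)
      obtain ⟨h1, h2⟩ := hedge (q := q.1) (y := z) (by linarith [ip_le_add_dist q.1 y' z])
      refine ⟨q.2, _, hqb, ?_, hp.step q hq h1⟩
      have : 0 ≤ (c q.1 q.2).toReal := ENNReal.toReal_nonneg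
      push_cast
      linarith
  have real' : ∀ ab : ι × ι, ∃ k : ℕ, Relation.ReflTransGen r ab.1 ab.2 → ∀ y, cell y = ab.1 →
      ∃ z w, cell z = ab.2 ∧ w ≤ k * L ∧ Path Γ c y z w := fun ab => by
    by_cases h : Relation.ReflTransGen r ab.1 ab.2
    · obtain ⟨k, hk⟩ := real _ _ h
      exact ⟨k, fun _ => hk⟩
    · exact ⟨0, fun h' => absurd h' h⟩
  choose k hk using real'
  refine ⟨Finset.univ.sup k + 1, fun p hp x hx => ?_⟩
  -- A neighbourhood of everything reachable from the cell of `p.2`. By `hNU`, a point of `Γ` whose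
  -- source lies in `N` has its target in `U`.
  set U : Set (Sphere m) :=
    {x | ∃ y, Relation.ReflTransGen r (cell p.2) (cell y) ∧ dist x y < s / 4} with hU
  have hUo : IsOpen U := by
    have : U = ⋃ y ∈ {y | Relation.ReflTransGen r (cell p.2) (cell y)}, Metric.ball y (s / 4) := by
      ext x
      simp [hU]
    rw [this]
    exact isOpen_biUnion fun y _ => Metric.isOpen_ball
  set N : Set (Sphere m) := {n | ∃ x ∈ closure U, s < ip n x} with hN
  have hNU : ∀ n ∈ N, ∃ y, Relation.ReflTransGen r (cell p.2) (cell y) ∧ s - s / 4 < ip n y := by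
    rintro n ⟨x, hx, hnx⟩
    have ho : IsOpen {x | s < ip n x} :=
      isOpen_lt continuous_const (continuous_ip.comp (Continuous.prodMk_right n))
    obtain ⟨x', hx', y, hy, hxy⟩ := mem_closure_iff.1 hx _ ho hnx
    have hx' : s < ip n x' := hx'
    exact ⟨y, hy, by linarith [ip_le_add_dist n x' y]⟩
  have hNo : IsOpen N := by
    have : N = ⋃ x ∈ closure U, {n | s < ip n x} := by
      ext n
      simp [hN]
    rw [this]
    exact isOpen_biUnion fun x _ =>
      isOpen_lt continuous_const (continuous_ip.comp (Continuous.prodMk_left x))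
  have hF := hall _ (isClosed_closure (s := U))
  rw [Measure.map_apply measurable_snd isClosed_closure.measurableSet,
    Measure.map_apply measurable_fst hNo.measurableSet] at hF
  have hsub : Prod.fst ⁻¹' N ⊆ (Prod.snd ⁻¹' closure U ∩ Prod.fst ⁻¹' N) ∪ Γᶜ := by
    intro q hq
    by_cases hqΓ : q ∈ Γ
    · left
      obtain ⟨y, hy, hip⟩ := hNU q.1 hq
      exact ⟨subset_closure ⟨q.2, hy.tail ⟨q, hqΓ, rfl, y, rfl, hip⟩, by simpa using by positivity⟩,
        hq⟩
    · exact Or.inr hqΓ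
  -- The Hall condition and `hsub` bound each of the two masses by the other, so almost all mass
  -- ending in `closure U` starts in `N`.
  have hzero : π (Prod.snd ⁻¹' closure U \ Prod.fst ⁻¹' N) = 0 := by
    have h1 := measure_inter_add_sdiff (μ := π) (Prod.snd ⁻¹' closure U)
      (measurable_fst (β := Sphere m) hNo.measurableSet)
    have h2 : π (Prod.fst ⁻¹' N) ≤ π (Prod.snd ⁻¹' closure U ∩ Prod.fst ⁻¹' N) := by
      refine (measure_mono hsub).trans ((measure_union_le _ _).trans ?_)
      rw [hΓ, add_zero]
    have h3 : π (Prod.snd ⁻¹' closure U ∩ Prod.fst ⁻¹' N) +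
        π (Prod.snd ⁻¹' closure U \ Prod.fst ⁻¹' N) ≤
        π (Prod.snd ⁻¹' closure U ∩ Prod.fst ⁻¹' N) + 0 := by
      rw [h1, add_zero]
      exact hF.trans h2
    exact le_antisymm ((ENNReal.add_le_add_iff_left (measure_ne_top _ _)).1 h3) bot_le
  have hp2 : p.2 ∈ U := ⟨p.2, .refl, by simpa using by positivity⟩
  -- As `p` is in the support, some `q` with source near `p.1` starts in `N`; hence `p.1` sees a
  -- reachable cell, from which one more edge leads to `p.2`.
  have hpos := (Measure.mem_support_iff_forall _).1 (hΓs hp) (Metric.ball p.1 (s / 4) ×ˢ U)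
    (prod_mem_nhds (Metric.ball_mem_nhds _ (by positivity)) (hUo.mem_nhds hp2))
  obtain ⟨q, hq, hqN⟩ : ∃ q ∈ Metric.ball p.1 (s / 4) ×ˢ U, q.1 ∈ N := by
    by_contra! h
    have hss : Metric.ball p.1 (s / 4) ×ˢ U ⊆ Prod.snd ⁻¹' closure U \ Prod.fst ⁻¹' N :=
      fun q hq => ⟨subset_closure hq.2, h q hq⟩
    exact hpos.ne' (measure_mono_null hss hzero)
  obtain ⟨y, hy, hip⟩ := hNU _ hqN
  obtain ⟨z, w, hz, hw, hpath⟩ := hk (cell p.2, cell y) hy x hx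
  have hzy := hcell y z hz.symm
  have hqp : dist q.1 p.1 < s / 4 := hq.1
  obtain ⟨h1, h2⟩ := hedge (q := p.1) (y := z)
    (by linarith [ip_le_add_dist q.1 y z, ip_le_add_dist' q.1 p.1 z])
  refine ⟨_, ?_, hpath.step p hp h1⟩
  have hkk : (k (cell p.2, cell y) : ℝ) ≤ (Finset.univ.sup k : ℕ) := by
    exact_mod_cast Finset.le_sup (f := k) (Finset.mem_univ _)
  have := mul_le_mul_of_nonneg_right hkk hL
  push_cast
  linarith

end Return

/-! ### From the weak Aleksandrov condition to a uniform Hall condition. -/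

section Hall

variable {m : ℕ}

/-- The cone over this set stays in `V`, which is Lebesgue-null. -/
lemma uniformMeasure_submodule (V : Submodule ℝ (EuclideanSpace ℝ (Fin (m + 1)))) (hV : V ≠ ⊤) :
    uniformMeasure m {n | (n : EuclideanSpace ℝ (Fin (m + 1))) ∈ V} = 0 := by
  have hcl : IsClosed {n : Sphere m | (n : EuclideanSpace ℝ (Fin (m + 1))) ∈ V} :=
    V.closed_of_finiteDimensional.preimage continuous_subtype_val
  rw [uniformMeasure, Measure.toSphere_apply' _ hcl.measurableSet]
  rw [measure_mono_null _ (Measure.addHaar_submodule volume V hV), mul_zero]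
  rintro _ ⟨t, -, _, ⟨n, hn, rfl⟩, rfl⟩
  exact V.smul_mem _ hn

/-- If the polar cone of a closed set is not negligible, the set lies in an open hemisphere. -/
lemma exists_pos_le_ip {F : Set (Sphere m)} (hF : IsClosed F) (hne : F.Nonempty)
    (h0 : uniformMeasure m {n | ∀ x ∈ F, ip n x ≤ 0} ≠ 0) :
    ∃ u : Sphere m, ∃ ε > 0, ∀ x ∈ F, ε ≤ ip u x := by
  set P : Set (Sphere m) := {n | ∀ x ∈ F, ip n x ≤ 0} with hP
  have hspan : Submodule.span ℝ ((↑) '' P : Set (EuclideanSpace ℝ (Fin (m + 1)))) = ⊤ := by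
    by_contra h
    refine h0 (measure_mono_null ?_ (uniformMeasure_submodule _ h))
    exact fun n hn => Submodule.subset_span (mem_image_of_mem _ hn)
  obtain ⟨f, hfP, hf, -⟩ := Submodule.exists_fun_fin_finrank_span_eq ℝ
    ((↑) '' P : Set (EuclideanSpace ℝ (Fin (m + 1))))
  replace hf := hf.trans hspan
  have hle : ∀ i, ∀ x ∈ F, ⟪f i, (x : EuclideanSpace ℝ (Fin (m + 1)))⟫ ≤ 0 := fun i x hx => by
    obtain ⟨n, hn, hni⟩ := hfP i
    rw [← hni]
    exact hn x hx
  -- The `f i` lie in the polar `P` and span the space, so a point of `F` orthogonal to `v` would be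
  -- orthogonal to everything.
  set v := -∑ i, f i with hv
  have hpos : ∀ x ∈ F, 0 < ⟪v, (x : EuclideanSpace ℝ (Fin (m + 1)))⟫ := by
    intro x hx
    rw [hv, inner_neg_left, sum_inner, neg_pos]
    refine lt_of_le_of_ne (Finset.sum_nonpos fun i _ => hle i x hx) fun h => ?_
    have hz := (Finset.sum_eq_zero_iff_of_nonpos fun i _ => hle i x hx).1 h
    have hx' : (x : EuclideanSpace ℝ (Fin (m + 1))) ∈ Submodule.span ℝ (range f) := by
      rw [hf]; trivial
    have : ∀ y ∈ Submodule.span ℝ (range f), ⟪y, (x : EuclideanSpace ℝ (Fin (m + 1)))⟫ = 0 := by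
      intro y hy
      induction hy using Submodule.span_induction with
      | mem y hy =>
        obtain ⟨i, rfl⟩ := hy
        exact hz i (Finset.mem_univ i)
      | zero => simp
      | add y z _ _ h1 h2 => rw [inner_add_left, h1, h2, add_zero]
      | smul a y _ h1 => rw [real_inner_smul_left, h1, mul_zero]
    have h1 := ip_self x
    rw [ip, this _ hx'] at h1
    exact zero_ne_one h1
  obtain ⟨x₀, hx₀, hmin⟩ := hF.isCompact.exists_isMinOn hne
    (f := fun x : Sphere m => ⟪v, (x : EuclideanSpace ℝ (Fin (m + 1)))⟫)
    (Continuous.continuousOn (by fun_prop))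
  have hv0 : v ≠ 0 := by
    intro h
    have := hpos x₀ hx₀
    rw [h, inner_zero_left] at this
    exact lt_irrefl _ this
  have hvn : 0 < ‖v‖ := norm_pos_iff.2 hv0
  refine ⟨⟨‖v‖⁻¹ • v, by simp [norm_smul, hvn.ne']⟩, _,
    mul_pos (inv_pos.2 hvn) (hpos x₀ hx₀), fun x hx => ?_⟩
  rw [ip, real_inner_smul_left]
  exact mul_le_mul_of_nonneg_left (hmin hx) (inv_pos.2 hvn).le

/-- The points seeing a point of `F` under an angle of cosine larger than `s`. -/
def seeing (F : Set (Sphere m)) (s : ℝ) : Set (Sphere m) := {n | ∃ x ∈ F, s < ip n x}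

lemma seeing_anti (F : Set (Sphere m)) {s t : ℝ} (h : s ≤ t) : seeing F t ⊆ seeing F s :=
  fun _ ⟨x, hx, hn⟩ => ⟨x, hx, h.trans_lt hn⟩

lemma isOpen_seeing (F : Set (Sphere m)) (s : ℝ) : IsOpen (seeing F s) := by
  have : seeing F s = ⋃ x ∈ F, {n | s < ip n x} := by
    ext n
    simp [seeing]
  rw [this]
  exact isOpen_biUnion fun x _ =>
    isOpen_lt continuous_const (continuous_ip.comp (Continuous.prodMk_left x))

lemma mem_closedHemisphere_neg {n x : Sphere m} (h : ip n x ≤ 0) : x ∈ closedHemisphere (-n) := by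
  simpa [closedHemisphere, ip] using h

/-- A set contained in no closed hemisphere is seen from everywhere under angles bounded away
from `π / 2`. -/
lemma exists_seeing_eq_univ {F : Set (Sphere m)} (hF : ¬ ∃ u, F ⊆ closedHemisphere u) :
    ∃ t > 0, seeing F t = univ := by
  have hsub : (univ : Set (Sphere m)) ⊆ ⋃ k : ℕ, seeing F (1 / (k + 1 : ℝ)) := by
    intro n _
    have : ∃ x ∈ F, 0 < ip n x := by
      by_contra! h
      exact hF ⟨-n, fun x hx => mem_closedHemisphere_neg (h x hx)⟩
    obtain ⟨x, hx, hn⟩ := this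
    obtain ⟨k, hk⟩ := exists_nat_one_div_lt hn
    exact mem_iUnion.2 ⟨k, x, hx, hk⟩
  obtain ⟨k, hk⟩ := isCompact_univ.elim_directed_cover _ (fun k => isOpen_seeing F _) hsub
    (Monotone.directed_le fun i j hij => seeing_anti F (Nat.one_div_le_one_div hij))
  exact ⟨_, Nat.one_div_pos_of_nat, univ_subset_iff.1 hk⟩

/-- These sets increase to the complement of the polar of `F`. -/
lemma tendsto_measure_seeing (lam : Measure (Sphere m)) [IsProbabilityMeasure lam]
    {F : Set (Sphere m)} (hF : lam {n | ∀ x ∈ F, ip n x ≤ 0} = 0) :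
    Tendsto (fun k : ℕ => lam (seeing F (1 / (k + 1 : ℝ)))) atTop (𝓝 1) := by
  have h := tendsto_measure_iUnion_atTop (μ := lam) (s := fun k : ℕ => seeing F (1 / (k + 1 : ℝ)))
    fun i j hij => seeing_anti F (Nat.one_div_le_one_div hij)
  suffices hone : lam (⋃ k : ℕ, seeing F (1 / (k + 1 : ℝ))) = 1 by rwa [hone] at h
  rw [← prob_compl_eq_zero_iff (MeasurableSet.iUnion fun k => (isOpen_seeing F _).measurableSet)]
  refine measure_mono_null ?_ hF
  intro n hn x hx
  by_contra! hpos
  obtain ⟨k, hk⟩ := exists_nat_one_div_lt hpos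
  exact hn (mem_iUnion.2 ⟨k, x, hx, hk⟩)

/-- The weak Aleksandrov condition implies a quantitative Hall condition for all closed sets. -/
theorem WeakAleksandrov.exists_hall {lam μ : Measure (Sphere m)} [IsProbabilityMeasure lam]
    [IsProbabilityMeasure μ] (hWA : WeakAleksandrov lam μ) (hlam : lam ≪ uniformMeasure m)
    (hμ : ¬ ∃ u : Sphere m, μ.support ⊆ closedHemisphere u) :
    ∃ s > 0, ∀ F : Set (Sphere m), IsClosed F → μ F ≤ lam (seeing F s) := by
  obtain ⟨α, ⟨hα0, hα⟩, hWA⟩ := hWA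
  have hs : 0 < Real.cos (Real.pi / 2 - 2 * α) :=
    Real.cos_pos_of_mem_Ioo ⟨by linarith, by linarith⟩
  set s := Real.cos (Real.pi / 2 - 2 * α) with hsdef
  by_contra! hcon
  have hcon' : ∀ k : ℕ, ∃ F : TopologicalSpace.NonemptyCompacts (Sphere m),
      lam (seeing F (s * (1 / (k + 1 : ℝ)))) < μ F := by
    intro k
    obtain ⟨F, hF, hlt⟩ := hcon (s * (1 / (k + 1 : ℝ))) (mul_pos hs Nat.one_div_pos_of_nat)
    have hne : F.Nonempty := by
      rw [nonempty_iff_ne_empty]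
      rintro rfl
      simp at hlt
    exact ⟨⟨⟨F, hF.isCompact⟩, hne⟩, hlt⟩
  choose G hG using hcon'
  -- Counterexamples at cosines at most `s` cannot satisfy the hypothesis of the weak Aleksandrov
  -- condition.
  have hGhemi : ∀ k, ¬ ∃ u, (G k : Set (Sphere m)) ⊆ closedHemisphere u := by
    intro k hk
    have h1 := hWA (G k) (G k).isCompact.isClosed hk
    refine (hG k).not_ge (h1.trans (measure_mono ?_))
    refine seeing_anti (G k : Set (Sphere m)) (mul_le_of_le_one_right hs.le ?_)
    rw [div_le_one (by positivity)]
    linarith [(Nat.cast_nonneg k : (0 : ℝ) ≤ k)]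
  obtain ⟨F, φ, hφ, hlim⟩ := CompactSpace.tendsto_subseq G
  have hFc : IsClosed (F : Set (Sphere m)) := F.isCompact.isClosed
  have hdist : ∀ ε > 0, ∀ᶠ k in atTop,
      Metric.hausdorffDist (F : Set (Sphere m)) (G (φ k)) < ε := by
    intro ε hε
    filter_upwards [Metric.tendsto_nhds.1 hlim ε hε] with k hk
    rwa [dist_comm, Metric.NonemptyCompacts.dist_eq] at hk
  have hfin : ∀ k, Metric.hausdorffEDist (F : Set (Sphere m)) (G (φ k)) ≠ ⊤ := fun k =>
    Metric.hausdorffEDist_ne_top_of_nonempty_of_bounded F.nonempty (G (φ k)).nonempty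
      F.isCompact.isBounded (G (φ k)).isCompact.isBounded
  have hsee : ∀ t > 0, ∀ᶠ k in atTop, lam (seeing F t) < μ (G (φ k)) := by
    intro t ht
    have hs0 : Tendsto (fun k => s * (1 / ((φ k : ℕ) + 1 : ℝ))) atTop (𝓝 (s * 0)) :=
      (tendsto_one_div_add_atTop_nhds_zero_nat.const_mul s).comp hφ.tendsto_atTop
    rw [mul_zero] at hs0
    filter_upwards [hs0.eventually_lt_const (half_pos ht), hdist _ (half_pos ht)] with k hk1 hk2
    refine (measure_mono ?_).trans_lt (hG (φ k))
    rintro n ⟨x, hx, hn⟩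
    obtain ⟨y, hy, hxy⟩ := Metric.exists_dist_lt_of_hausdorffDist_lt hx hk2 (hfin k)
    exact ⟨y, hy, by linarith [ip_le_add_dist n x y]⟩
  -- Otherwise the limit `F` lies in an open hemisphere with a margin, and so do nearby `G (φ k)`.
  have hnull : lam {n | ∀ x ∈ (F : Set (Sphere m)), ip n x ≤ 0} = 0 := by
    refine hlam ?_
    by_contra h0
    obtain ⟨u, ε, hε, hu⟩ := exists_pos_le_ip hFc F.nonempty h0
    obtain ⟨k, hk⟩ := (hdist ε hε).exists
    refine hGhemi (φ k) ⟨u, fun y hy => ?_⟩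
    obtain ⟨x, hx, hxy⟩ := Metric.exists_dist_lt_of_hausdorffDist_lt' hy hk (hfin k)
    have := hu x hx
    have h2 := ip_le_add_dist u x y
    change 0 ≤ ip u y
    linarith
  -- By `hsee` and `hnull`, the sets `G (φ k)` carry `μ`-mass tending to one while entering every
  -- thickening of `F`.
  have hμF : μ F = 1 := by
    have hthick : ∀ ε > 0, 1 ≤ μ (Metric.cthickening ε F) := by
      intro ε hε
      refine le_of_tendsto' (tendsto_measure_seeing lam hnull) fun j => ?_
      obtain ⟨k, hk1, hk2⟩ := ((hsee _ (Nat.one_div_pos_of_nat (n := j))).and (hdist ε hε)).exists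
      refine hk1.le.trans (measure_mono fun y hy => ?_)
      obtain ⟨x, hx, hxy⟩ := Metric.exists_dist_lt_of_hausdorffDist_lt' hy hk2 (hfin k)
      exact Metric.mem_cthickening_of_dist_le y x ε _ hx (by rw [dist_comm]; exact hxy.le)
    refine le_antisymm prob_le_one ?_
    have ht := tendsto_measure_cthickening_of_isClosed (μ := μ) (s := (F : Set (Sphere m)))
      ⟨1, one_pos, measure_ne_top _ _⟩ hFc
    refine ge_of_tendsto (ht.mono_left (nhdsWithin_le_nhds (s := Ioi 0))) ?_
    filter_upwards [self_mem_nhdsWithin] with ε hε using hthick ε hε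
  have hsupp : μ.support ⊆ F :=
    Measure.support_subset_of_isClosed hFc ((prob_compl_eq_zero_iff hFc.measurableSet).2 hμF)
  obtain ⟨t, ht, hun⟩ := exists_seeing_eq_univ (F := (F : Set (Sphere m)))
    fun ⟨u, hu⟩ => hμ ⟨u, hsupp.trans hu⟩
  obtain ⟨k, hk⟩ := (hsee t ht).exists
  rw [hun, measure_univ] at hk
  exact hk.not_ge prob_le_one

end Hall

/-! ### The logarithmic cost and its transforms. -/

section Cost

variable {m : ℕ}

lemma cost_of_pos {n x : Sphere m} (h : 0 < ip n x) :
    cost n x = ENNReal.ofReal (-Real.log (ip n x)) := if_pos h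

lemma cost_of_nonpos {n x : Sphere m} (h : ip n x ≤ 0) : cost n x = ⊤ := if_neg h.not_gt

lemma cost_lt_top_iff {n x : Sphere m} : cost n x < ⊤ ↔ 0 < ip n x := by
  unfold cost
  split_ifs with h <;> simp [h]

lemma cost_comm (n x : Sphere m) : cost n x = cost x n := by
  rw [cost, cost, ip_comm]

lemma toReal_cost {n x : Sphere m} (h : 0 < ip n x) :
    (cost n x).toReal = -Real.log (ip n x) := by
  rw [cost_of_pos h, ENNReal.toReal_ofReal]
  have := Real.log_nonpos h.le (ip_le_one n x)
  linarith

lemma cost_le_of_le {n x : Sphere m} {t : ℝ} (ht : 0 < t) (h : t ≤ ip n x) :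
    cost n x ≤ ENNReal.ofReal (-Real.log t) := by
  rw [cost_of_pos (ht.trans_le h)]
  exact ENNReal.ofReal_le_ofReal (neg_le_neg (Real.log_le_log ht h))

/-- A single formula through the extended logarithm, so that continuity holds across `ip n x = 0`.
-/
lemma cost_eq_toENNReal (n x : Sphere m) :
    cost n x = (-(ENNReal.log (ENNReal.ofReal (ip n x)))).toENNReal := by
  rcases lt_or_ge 0 (ip n x) with h | h
  · rw [cost_of_pos h, ENNReal.log_ofReal_of_pos h, ← EReal.coe_neg, EReal.toENNReal_of_ne_top
      (EReal.coe_ne_top _), EReal.toReal_coe]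
  · rw [cost_of_nonpos h, ENNReal.ofReal_of_nonpos h, ENNReal.log_zero, EReal.neg_bot,
      EReal.toENNReal_top]

lemma continuous_cost : Continuous fun p : Sphere m × Sphere m => cost p.1 p.2 := by
  simp_rw [cost_eq_toENNReal]
  exact EReal.continuous_toENNReal.comp (continuous_neg.comp
    (ENNReal.continuous_log.comp (ENNReal.continuous_ofReal.comp continuous_ip)))

lemma le_cTransform_iff {h : Sphere m → ℝ} {n : Sphere m} {r : ℝ} :
    (r : EReal) ≤ cTransform (toExt h) n ↔
      ∀ x, cost n x < ⊤ → r + h x ≤ (cost n x).toReal := by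
  rw [cTransform, le_iInf_iff]
  refine forall_congr' fun x => ?_
  rcases eq_or_ne (cost n x) ⊤ with hx | hx
  · simp [hx, toExt]
  · lift cost n x to ℝ≥0 using hx with a
    simp only [toExt, ENNReal.coe_lt_top, true_imp_iff, ENNReal.coe_toReal,
      EReal.coe_nnreal_eq_coe_real, ← EReal.coe_sub, EReal.coe_le_coe_iff, le_sub_iff_add_le]

/-- The `c`-transform of a bounded function is bounded and Lipschitz. -/
lemma exists_lipschitz_cTransform {h : Sphere m → ℝ} {M : ℝ} (hM : ∀ x, |h x| ≤ M) :
    ∃ (φ : Sphere m → ℝ) (K : ℝ≥0), LipschitzWith K φ ∧ (∀ n, |φ n| ≤ M) ∧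
      cTransform (toExt h) = toExt φ := by
  -- A pair of cosine below `t` costs more than `2 * M`, so it cannot beat the choice `x = n`, which
  -- costs zero. Truncating at `t` thus keeps the infimum and makes the cost Lipschitz with constant
  -- `t⁻¹`.
  set t : ℝ := Real.exp (-(2 * M)) with ht
  have ht0 : 0 < t := Real.exp_pos _
  have hlogt : Real.log t = -(2 * M) := Real.log_exp _
  set G : ℝ → ℝ := fun a => -Real.log (max a t) with hG
  have hM' := fun x => abs_le.1 (hM x)
  have hM0 : 0 ≤ M := (abs_nonneg _).trans
    (hM ⟨EuclideanSpace.single 0 1, by simp⟩)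
  have ht1 : t ≤ 1 := Real.exp_le_one_iff.2 (by linarith)
  have hG0 : ∀ n x : Sphere m, 0 ≤ G (ip n x) := fun n x => by
    have := Real.log_nonpos (ht0.le.trans (le_max_right (ip n x) t)) (max_le (ip_le_one n x) ht1)
    simpa [hG] using this
  have hGlip : ∀ a b, G a ≤ G b + t⁻¹ * |a - b| := by
    intro a b
    have ha : 0 < max a t := lt_max_of_lt_right ht0
    have hb : 0 < max b t := lt_max_of_lt_right ht0
    have h1 := Real.log_le_sub_one_of_pos (div_pos hb ha)
    rw [Real.log_div hb.ne' ha.ne'] at h1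
    have h2 : max b t / max a t - 1 ≤ t⁻¹ * |a - b| := by
      rw [div_sub_one ha.ne', div_eq_inv_mul]
      have h3 : max b t - max a t ≤ |a - b| := by
        rw [abs_sub_comm]
        exact (le_abs_self _).trans (abs_max_sub_max_le_abs _ _ _)
      calc (max a t)⁻¹ * (max b t - max a t) ≤ (max a t)⁻¹ * |a - b| := by gcongr
        _ ≤ t⁻¹ * |a - b| := by
          gcongr
          exact le_max_right _ _
    simp only [hG]
    linarith
  have hbdd : ∀ n, BddBelow (range fun x => G (ip n x) - h x) := fun n =>
    ⟨-M, by rintro _ ⟨x, rfl⟩; linarith [hG0 n x, (hM' x).2]⟩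
  have hne : Nonempty (Sphere m) := ⟨⟨EuclideanSpace.single 0 1, by simp⟩⟩
  set φ : Sphere m → ℝ := fun n => ⨅ x, (G (ip n x) - h x) with hφ
  have hφle : ∀ n x, φ n ≤ G (ip n x) - h x := fun n x => ciInf_le (hbdd n) x
  have hGn : ∀ n : Sphere m, G (ip n n) = 0 := fun n => by
    simp [hG, ip_self, max_eq_left ht1]
  refine ⟨φ, Real.toNNReal t⁻¹, LipschitzWith.of_le_add_mul _ fun n n' => ?_,
    fun n => abs_le.2 ⟨le_ciInf fun x => by linarith [hG0 n x, (hM' x).2], ?_⟩, ?_⟩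
  · rw [← sub_le_iff_le_add]
    refine le_ciInf fun x => ?_
    have h1 := hGlip (ip n x) (ip n' x)
    have h2 : |ip n x - ip n' x| ≤ dist n n' := abs_sub_le_iff.2
      ⟨by linarith [ip_le_add_dist' n n' x],
        by linarith [ip_le_add_dist' n' n x, dist_comm n n']⟩
    have h3 : t⁻¹ * |ip n x - ip n' x| ≤ t⁻¹ * dist n n' :=
      mul_le_mul_of_nonneg_left h2 (inv_pos.2 ht0).le
    have := hφle n x
    rw [Real.coe_toNNReal _ (inv_pos.2 ht0).le]
    linarith
  · linarith [hφle n n, hGn n, (hM' n).1]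
  · funext n
    refine le_antisymm (EReal.le_of_forall_lt_iff_le.1 fun r hr => ?_)
      (le_cTransform_iff.2 fun x hx => ?_)
    · obtain ⟨x, hx⟩ := exists_lt_of_ciInf_lt (EReal.coe_lt_coe_iff.1 hr)
      have key : ∀ y, 0 < ip n y → (cost n y).toReal - h y ≤ r →
          cTransform (toExt h) n ≤ (r : EReal) := by
        intro y hy hr
        refine (iInf_le _ y).trans ?_
        have hy' := (cost_lt_top_iff.2 hy).ne
        lift cost n y to ℝ≥0 using hy' with a
        rw [toExt, EReal.coe_nnreal_eq_coe_real, ← EReal.coe_sub, EReal.coe_le_coe_iff]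
        exact hr
      rcases le_or_gt t (ip n x) with htx | htx
      · refine key x (ht0.trans_le htx) ?_
        rw [toReal_cost (ht0.trans_le htx)]
        simp only [hG, max_eq_left htx] at hx
        exact hx.le
      · refine key n (by rw [ip_self]; exact one_pos) ?_
        rw [toReal_cost (by rw [ip_self]; exact one_pos), ip_self, Real.log_one]
        simp only [hG, max_eq_right htx.le, hlogt] at hx
        linarith [(hM' n).1, (hM' x).2]
    · have hx' := cost_lt_top_iff.1 hx
      have h1 := hφle n x
      have h2 : G (ip n x) ≤ (cost n x).toReal := by
        rw [toReal_cost hx']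
        exact neg_le_neg (Real.log_le_log hx' (le_max_left _ _))
      linarith

/-- Bounded potentials give a Kantorovich potential with a larger `c`-subdifferential. -/
lemma exists_kantorovichPotential {Γ : Set (Sphere m × Sphere m)} {M : ℝ} {g : Sphere m → ℝ}
    (hg : ∀ y, -M ≤ g y ∧ g y ≤ 0) (hfin : ∀ p ∈ Γ, cost p.1 p.2 < ⊤)
    (hΓ : ∀ p ∈ Γ, ∀ y, cost p.1 y < ⊤ →
      (cost p.1 p.2).toReal + g p.2 ≤ (cost p.1 y).toReal + g y) :
    ∃ φ : Sphere m → ℝ, IsKantorovichPotential φ ∧ Γ ⊆ cSubdifferential φ := by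
  obtain ⟨φ, K, hφK, hφM, hφ⟩ := exists_lipschitz_cTransform (h := fun y => -g y) (M := M)
    fun y => by rw [abs_neg]; exact abs_le.2 ⟨(hg y).1, by linarith [(hg y).1, (hg y).2]⟩
  obtain ⟨ψ, K', hψK, hψM, hψ⟩ := exists_lipschitz_cTransform hφM
  obtain ⟨φ', -, -, -, hφ'⟩ := exists_lipschitz_cTransform hψM
  have h1 : ∀ n (r : ℝ), r ≤ φ n ↔ ∀ x, cost n x < ⊤ → r + -g x ≤ (cost n x).toReal := fun n r => by
    rw [← le_cTransform_iff (h := fun y => -g y), hφ, toExt, EReal.coe_le_coe_iff]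
  have h2 : ∀ n (r : ℝ), r ≤ ψ n ↔ ∀ x, cost n x < ⊤ → r + φ x ≤ (cost n x).toReal := fun n r => by
    rw [← le_cTransform_iff, hψ, toExt, EReal.coe_le_coe_iff]
  have h3 : ∀ n (r : ℝ), r ≤ φ' n ↔ ∀ x, cost n x < ⊤ → r + ψ x ≤ (cost n x).toReal := fun n r => by
    rw [← le_cTransform_iff, hφ', toExt, EReal.coe_le_coe_iff]
  have hgψ : ∀ x, -g x ≤ ψ x := fun x => (h2 x _).2 fun n hn => by
    rw [cost_comm] at hn ⊢
    linarith [(h1 n _).1 le_rfl x hn]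
  have hsum : ∀ n x, cost n x < ⊤ → φ n + ψ x ≤ (cost n x).toReal := fun n x hn => by
    rw [cost_comm] at hn ⊢
    linarith [(h2 x _).1 le_rfl n hn]
  -- A triple transform equals the single one: `-g ≤ ψ` gives one inequality, `hsum` the other.
  have heq : φ' = φ := by
    funext n
    refine le_antisymm ((h1 n _).2 fun x hx => ?_) ((h3 n _).2 fun x hx => hsum n x hx)
    linarith [(h3 n _).1 le_rfl x hx, hgψ x]
  refine ⟨φ, ⟨⟨K, hφK⟩, ⟨ψ, K', hψK, hψ⟩, by rw [hψ, hφ', heq]⟩, fun p hp => ?_⟩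
  have hlow : (cost p.1 p.2).toReal + g p.2 ≤ φ p.1 := (h1 _ _).2 fun y hy => by
    linarith [hΓ p hp y hy]
  have hval : φ p.1 + ψ p.2 = (cost p.1 p.2).toReal :=
    le_antisymm (hsum _ _ (hfin p hp)) (by linarith [hgψ p.2])
  change toExt φ p.1 + cTransform (toExt φ) p.2 = _
  rw [hψ, toExt, toExt, ← EReal.coe_add, hval, EReal.coe_ennreal_toReal (hfin p hp).ne]

end Cost

/-! ### Existence of a plan of finite cost. -/

section Plans

variable {m : ℕ}

/-- Under a quantitative Hall condition, there is a transport plan of finite cost. -/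
theorem exists_transportPlan_planCost_lt_top {lam μ : Measure (Sphere m)} [IsProbabilityMeasure lam]
    [IsProbabilityMeasure μ] {s : ℝ} (hs : 0 < s)
    (hall : ∀ F : Set (Sphere m), IsClosed F → μ F ≤ lam (seeing F s)) :
    ∃ π ∈ transportPlans lam μ, planCost π < ⊤ := by
  -- This bounded cost vanishes exactly where the cosine is at least `s / 4`, so return edges are
  -- free.
  set f : C(Sphere m × Sphere m, ℝ≥0) :=
    ⟨fun p => Real.toNNReal (s / 4 - ip p.1 p.2),
      continuous_real_toNNReal.comp (continuous_const.sub continuous_ip)⟩ with hf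
  set c : Sphere m → Sphere m → ℝ≥0∞ := fun n x => f (n, x) with hc
  have hcont : Continuous fun p : Sphere m × Sphere m => c p.1 p.2 :=
    ENNReal.continuous_coe.comp f.continuous
  set T : Set (ProbabilityMeasure (Sphere m × Sphere m)) :=
    {P | P.map continuous_fst.measurable.aemeasurable = ⟨lam, inferInstance⟩ ∧
      P.map continuous_snd.measurable.aemeasurable = ⟨μ, inferInstance⟩} with hT
  have hTmem : ∀ P : ProbabilityMeasure (Sphere m × Sphere m), P ∈ T ↔
      (P : Measure (Sphere m × Sphere m)) ∈ transportPlans lam μ := fun P =>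
    and_congr Subtype.ext_iff Subtype.ext_iff
  have hTc : IsClosed T :=
    (isClosed_eq (ProbabilityMeasure.continuous_map continuous_fst) continuous_const).inter
      (isClosed_eq (ProbabilityMeasure.continuous_map continuous_snd) continuous_const)
  have hTne : T.Nonempty := by
    refine ⟨⟨lam.prod μ, inferInstance⟩, (hTmem _).2 ⟨?_, ?_⟩⟩
    · simp [Measure.map_fst_prod]
    · simp [Measure.map_snd_prod]
  obtain ⟨P, hPT, hPmin⟩ := hTc.isCompact.exists_isMinOn hTne
    (ProbabilityMeasure.continuous_lintegral_continuousMap f).continuousOn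
  have hP := (hTmem P).1 hPT
  set π := P.toMeasure with hπ
  have hmin : Minimizes c π := by
    intro π' h1 h2
    have hprob : IsProbabilityMeasure π' := by
      have : IsProbabilityMeasure (π'.map Prod.fst) := by
        rw [h1, hP.1]; infer_instance
      exact Measure.isProbabilityMeasure_of_map Prod.fst
    exact hPmin ((hTmem ⟨π', hprob⟩).2 ⟨h1.trans hP.1, h2.trans hP.2⟩)
  have hfin : ∫⁻ p, c p.1 p.2 ∂π ≠ ⊤ := by
    refine ne_top_of_le_ne_top (b := ENNReal.ofReal (s / 4 + 1)) ENNReal.ofReal_ne_top ?_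
    calc ∫⁻ p, c p.1 p.2 ∂π ≤ ∫⁻ _, ENNReal.ofReal (s / 4 + 1) ∂π := by
          refine lintegral_mono fun p => ENNReal.ofReal_le_ofReal ?_
          have := ip_le_one (-p.1) p.2
          have : ip (-p.1) p.2 = -ip p.1 p.2 := by simp [ip]
          linarith
      _ = _ := by simp
  have hlt : ∀ n x, c n x < ⊤ := fun n x => ENNReal.coe_lt_top
  have hclosed : ∀ (y : Sphere m) (w : ℝ), Path π.support c y y w → 0 ≤ w := fun y w h =>
    h.nonneg_of_cyclicallyMonotone (fun p _ => hlt _ _) fun k p hp σ =>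
      hmin.sum_le_sum hcont hfin p (fun i => ⟨hp i, hlt _ _⟩) σ
  obtain ⟨t, ht, cell, hcell⟩ := exists_cells (Sphere m) (δ := s / 4) (by positivity)
  have : Finite t := ht
  obtain ⟨k, hk⟩ := exists_return_path (π := π) (c := c) hs
    (fun F hF => by rw [hP.1, hP.2]; exact hall F hF)
    le_rfl Measure.measure_compl_support le_rfl
    (fun n x h => by
      simp only [hc, hf, ContinuousMap.coe_mk, ENNReal.ofReal_zero, nonpos_iff_eq_zero,
        ENNReal.coe_eq_zero, Real.toNNReal_eq_zero]
      linarith) cell hcell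
  -- With `L = 0` the closed chain through `p` has weight at most `-c p.1 p.2`; being nonnegative,
  -- it forces this cost to vanish.
  have hsupp : ∀ p ∈ π.support, s / 4 ≤ ip p.1 p.2 := by
    intro p hp
    obtain ⟨w, hw, hpath⟩ := hk p hp p.2 rfl
    have h0 := hclosed _ _ hpath
    have h1 : (c p.1 p.2).toReal = max (s / 4 - ip p.1 p.2) 0 := by
      simp [hc, hf]
    have := le_max_left (s / 4 - ip p.1 p.2) 0
    linarith
  refine ⟨π, hP, ?_⟩
  calc planCost π ≤ ∫⁻ _, ENNReal.ofReal (-Real.log (s / 4)) ∂π :=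
        lintegral_mono_ae (by
          filter_upwards [Measure.support_mem_ae (μ := π)] with p hp
            using cost_le_of_le (by positivity) (hsupp p hp))
    _ < ⊤ := by simp

end Plans

end GaussImage

end

theorem theorem3p2 (m : ℕ)
    (lam μ : MeasureTheory.Measure (GaussImage.Sphere m))
    [MeasureTheory.IsProbabilityMeasure lam] [MeasureTheory.IsProbabilityMeasure μ]
    (hWA : GaussImage.WeakAleksandrov lam μ)
    (hlam : MeasureTheory.Measure.AbsolutelyContinuous lam (GaussImage.uniformMeasure m))
    (hμ : ¬ ∃ u : GaussImage.Sphere m, μ.support ⊆ GaussImage.closedHemisphere u)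
    (πo : MeasureTheory.Measure (GaussImage.Sphere m × GaussImage.Sphere m))
    (hπo : GaussImage.IsOptimalPlan lam μ πo) :
    ∃ φ : GaussImage.Sphere m → ℝ, GaussImage.IsKantorovichPotential φ ∧
      πo.support ∩ {p | GaussImage.cost p.1 p.2 < ⊤} ⊆ GaussImage.cSubdifferential φ := by
  open GaussImage in
  obtain ⟨s, hs, hall⟩ := hWA.exists_hall hlam hμ
  obtain ⟨⟨h1, h2⟩, hopt⟩ := hπo
  obtain ⟨π', hπ', hlt⟩ := exists_transportPlan_planCost_lt_top hs hall
  have hfin : planCost πo < ⊤ := (hopt π' hπ').trans_lt hlt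
  have hprob : IsProbabilityMeasure πo := by
    have : IsProbabilityMeasure (πo.map Prod.fst) := by
      rw [h1]; infer_instance
    exact Measure.isProbabilityMeasure_of_map Prod.fst
  have hmin : Minimizes cost πo := fun π h h' => hopt π ⟨h.trans h1, h'.trans h2⟩
  set Γ := πo.support ∩ {p | cost p.1 p.2 < ⊤} with hΓ
  have hΓ0 : πo Γᶜ = 0 := by
    have h3 : ∀ᵐ p ∂πo, p ∈ Γ := by
      filter_upwards [Measure.support_mem_ae (μ := πo),
        ae_lt_top continuous_cost.measurable hfin.ne] with p hp hp' using ⟨hp, hp'⟩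
    exact h3
  have hclosed : ∀ (y : Sphere m) (w : ℝ), Path Γ cost y y w → 0 ≤ w := fun y w h =>
    h.nonneg_of_cyclicallyMonotone (fun p hp => hp.2) fun k p hp σ =>
      hmin.sum_le_sum continuous_cost hfin.ne p hp σ
  obtain ⟨t, ht, cell, hcell⟩ := exists_cells (Sphere m) (δ := s / 4) (by positivity)
  have : Finite t := ht
  -- The maximum with `0` is needed because no upper bound on `s` is available.
  obtain ⟨k, hk⟩ := exists_return_path (π := πo) (L := max (-Real.log (s / 4)) 0) hs
    (fun F hF => by rw [h1, h2]; exact hall F hF)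
    inter_subset_left hΓ0 (le_max_right _ _)
    (fun n x h => (cost_le_of_le (by positivity) h.le).trans
      (ENNReal.ofReal_le_ofReal (le_max_left _ _))) cell hcell
  set K : ℝ := k * max (-Real.log (s / 4)) 0
  -- Taking `y = p.2` in the return estimate closes the chain, so its nonnegativity bounds the cost
  -- on `Γ` by `K`.
  obtain ⟨M, hM⟩ := Path.exists_lower_bound (K := K) cell hclosed
    (fun p hp => by
      obtain ⟨w, hw, hpath⟩ := hk p hp p.2 rfl
      linarith [hclosed _ _ hpath])
    (fun p hp y hy => by
      obtain ⟨w, hw, hpath⟩ := hk p hp y hy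
      have : 0 ≤ (cost p.1 p.2).toReal := ENNReal.toReal_nonneg
      exact ⟨w, by linarith, hpath⟩)
  obtain ⟨g, hg, hgΓ⟩ := exists_bounded_potential hM
  exact exists_kantorovichPotential hg (fun p hp => hp.2) hgΓ
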